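/- Let $\Gamma$ be a finite quiver with vertex set $I$ and $\mathbf v=(v_i)_{i\in I}\in(\mathbb Z_{\ge 0})^I$ a non-zero dimension vector. For a field $K$ let $\mathrm{GL}_{\mathbf v}(K)=\prod_{i}\mathrm{GL}_{v_i}(K)$ act on $\mathrm{Rep}_K(\Gamma,\mathbf v)=\bigoplus_{i\to j}\mathrm{Mat}_{v_j,v_i}(K)$, the sum being over the arrows of $\Gamma$, by $(g\cdot\rho)_{i\to j}=g_j\,\rho_{i\to j}\,g_i^{-1}$. The Kac polynomial $A_{\mathbf v}(t)\in\mathbb Q[t]$ is the polynomial such that, for every finite field $\mathbb F_q$, $A_{\mathbf v}(q)$ is the number of isomorphism classes of absolutely indecomposable representations in $\mathrm{Rep}_{\mathbb F_q}(\Gamma,\mathbf v)$, that is, of representations that are indecomposable after extension of scalars to $\overline{\mathbb F}_q$. Let $\mathbb F_q$ be a finite field, $\kappa$ an algebraically closed field of characteristic zero, and $\alpha_{\mathbf v}:\mathbb F_q^\times\to\kappa^\times$ a character of order exactly $\sum_i v_i$. Put $1^{\alpha_{\mathbf v}}(g)=\prod_i\alpha_{\mathbf v}(\det g_i)$ and $R_{\mathbf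 v}(g)=\#\{\rho\in\mathrm{Rep}_{\mathbb F_q}(\Gamma,\mathbf v)\mid g\cdot\rho=\rho\}$ for $g\in\mathrm{GL}_{\mathbf v}(\mathbb F_q)$; the latter is the character of the permutation representation of $\mathrm{GL}_{\mathbf v}(\mathbb F_q)$ on $\kappa[\mathrm{Rep}_{\mathbb F_q}(\Gamma,\mathbf v)]$. Then $$A_{\mathbf v}(q)=\langle R_{\mathbf v},1^{\alpha_{\mathbf v}}\rangle:=\frac1{|\mathrm{GL}_{\mathbf v}(\mathbb F_q)|}\sum_{g\in\mathrm{GL}_{\mathbf v}(\mathbb F_q)}R_{\mathbf v}(g)\,1^{\alpha_{\mathbf v}}(g^{-1}).$$ Here $A_{\mathbf v}(q)$ may be read either as the above number of isomorphism classes over $\mathbb F_q$ or as the value at $q$ of the Kac polynomial. Moreover $\langle R_{\mathbf v},1^{\alpha_{\mathbf v}}\rangle$ is the multiplicity of $1^{\alpha_{\mathbf v}}$ in the permutation representation, i.e. the dimension of the space of $f\in\kappa[\mathrm{Rep}_{\mathbb F_q}(\Gamma,\mathbf v)]$ with $g\cdot f=1^{\alpha_{\mathbf v}}(g)f$ for all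 $g$. -/

import Mathlib

universe w

namespace KacMultiplicity

/-- `Rep_K(Γ, v)`: a `v j × v i` matrix over `K` for every arrow `i ⟶ j` of the quiver. -/
def QuiverRep (I : Type*) [Quiver I] (v : I → ℕ) (K : Type*) : Type _ :=
  ∀ (i j : I), (i ⟶ j) → Matrix (Fin (v j)) (Fin (v i)) K

/-- `GL_v(K) = ∏ i, GL_{v i}(K)`. -/
abbrev GLv {I : Type*} (v : I → ℕ) (K : Type*) [Field K] : Type _ :=
  ∀ i : I, Matrix.GeneralLinearGroup (Fin (v i)) K

section Rep

variable {I : Type*} [Quiver I] {v : I → ℕ} {K : Type*} [Field K]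

/-- The usual action: `(g • ρ)_a = g_j ρ_a g_i⁻¹` for an arrow `a : i ⟶ j`.
Its orbits are the isomorphism classes of representations of dimension vector `v`. -/
instance : MulAction (GLv v K) (QuiverRep I v K) where
  smul g ρ := fun i j a =>
    (g j : Matrix (Fin (v j)) (Fin (v j)) K) * ρ i j a *
      ((g i)⁻¹ : Matrix.GeneralLinearGroup (Fin (v i)) K).val
  one_smul ρ := by
    funext i j a
    change (1 : Matrix (Fin (v j)) (Fin (v j)) K) * ρ i j a *
      ((1 : Matrix.GeneralLinearGroup (Fin (v i)) K)⁻¹).val = ρ i j a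
    simp
  mul_smul g h ρ := by
    funext i j a
    change (g j * h j).val * ρ i j a * ((g i * h i)⁻¹).val =
      (g j).val * ((h j).val * ρ i j a * ((h i)⁻¹).val) * ((g i)⁻¹).val
    rw [mul_inv_rev, Units.val_mul, Units.val_mul]
    simp only [Matrix.mul_assoc]

theorem smul_apply (g : GLv v K) (ρ : QuiverRep I v K) (i j : I) (a : i ⟶ j) :
    (g • ρ) i j a = (g j).val * ρ i j a * ((g i)⁻¹).val := rfl

/-- Extension of scalars along `K → L`. -/
def QuiverRep.baseChange (ρ : QuiverRep I v K) (L : Type*) [Field L] [Algebra K L] :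
    QuiverRep I v L :=
  fun i j a => (ρ i j a).map (algebraMap K L)

/-- A family of subspaces `U i ⊆ K^{v i}` that is a subrepresentation. -/
def QuiverRep.IsSubrep (ρ : QuiverRep I v K) (U : ∀ i, Submodule K (Fin (v i) → K)) : Prop :=
  ∀ (i j : I) (a : i ⟶ j), ∀ x ∈ U i, (ρ i j a).mulVec x ∈ U j

/-- A representation is indecomposable if it is non-zero and is not the direct sum of two
non-zero subrepresentations. -/
def QuiverRep.IsIndecomposable (ρ : QuiverRep I v K) : Prop :=
  v ≠ 0 ∧ ∀ U W : ∀ i, Submodule K (Fin (v i) → K), ρ.IsSubrep U → ρ.IsSubrep W →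
    (∀ i, IsCompl (U i) (W i)) → (∀ i, U i = ⊥) ∨ (∀ i, W i = ⊥)

/-- Absolutely indecomposable: indecomposable after extension of scalars to `K̄`. -/
def QuiverRep.IsAbsIndecomposable (ρ : QuiverRep I v K) : Prop :=
  (ρ.baseChange (AlgebraicClosure K)).IsIndecomposable

end Rep

/-- The number of isomorphism classes of absolutely indecomposable representations of
dimension vector `v` over `K`. -/
noncomputable def numAbsIndecomposable (I : Type*) [Quiver I] (v : I → ℕ)
    (K : Type*) [Field K] : ℕ :=
  Set.ncard {c : MulAction.orbitRel.Quotient (GLv v K) (QuiverRep I v K) |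
    ∃ ρ : QuiverRep I v K, ρ.IsAbsIndecomposable ∧ Quotient.mk _ ρ = c}

/-- `A` is the Kac polynomial `A_v(t)` of the quiver: for every finite field with `q` elements,
`A(q)` is the number of isomorphism classes of absolutely indecomposable representations of
dimension vector `v`. (There is at most one such polynomial, as it is prescribed at infinitely
many points.) -/
def IsKacPolynomial (I : Type*) [Quiver I] (v : I → ℕ) (A : Polynomial ℚ) : Prop :=
  ∀ (K : Type w) [Field K] [Finite K],
    A.eval (Nat.card K : ℚ) = (numAbsIndecomposable I v K : ℚ)

/-- The character `R_v` of the permutation representation, as a fixed-point count. -/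
noncomputable def permChar (I : Type*) [Quiver I] (v : I → ℕ) (K : Type*) [Field K]
    (κ : Type*) [Field κ] (g : GLv v K) : κ :=
  (Nat.card {ρ : QuiverRep I v K // g • ρ = ρ} : κ)

/-- The linear character `1^α : g ↦ ∏ i, α (det g_i)` of `GL_v(K)`. -/
def linChar {I : Type*} [Fintype I] (v : I → ℕ) {K : Type*} [Field K] {κ : Type*} [Field κ]
    (α : Kˣ →* κˣ) : GLv v K →* κˣ where
  toFun g := ∏ i, α (Matrix.GeneralLinearGroup.det (g i))
  map_one' := by simp
  map_mul' g h := by simp [Finset.prod_mul_distrib]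

/-- The inner product `⟨f, g⟩ = |G|⁻¹ ∑ x, f x * g (x⁻¹)` of characters of a finite group with
values in a field `κ`. For `κ = ℂ` and a linear character `g`, `g (x⁻¹)` is the complex conjugate
of `g x` (see `charInner_complex`). -/
noncomputable def charInner {G : Type*} [Group G] {κ : Type*} [Field κ] (f g : G → κ) : κ :=
  (Nat.card G : κ)⁻¹ * ∑ᶠ x : G, f x * g x⁻¹

theorem charInner_complex {G : Type*} [Group G] [Finite G] (f : G → ℂ) (χ : G →* ℂˣ) :
    charInner f (fun x => (χ x : ℂ)) =
      (Nat.card G : ℂ)⁻¹ * ∑ᶠ x : G, f x * (starRingEnd ℂ) (χ x : ℂ) := by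
  unfold charInner
  congr 1
  refine finsum_congr fun x => ?_
  have h : ‖(χ x : ℂ)‖ = 1 := by
    refine Complex.norm_eq_one_of_pow_eq_one (n := Nat.card G) ?_ Nat.card_pos.ne'
    rw [← Units.val_pow_eq_pow_val, ← map_pow, pow_card_eq_one']
    simp
  have h2 : ((χ x⁻¹ : ℂˣ) : ℂ) = (starRingEnd ℂ) (χ x : ℂ) := by
    rw [map_inv, Units.val_inv_eq_inv_val, Complex.inv_eq_conj h]
  rw [← h2]

/-- The multiplicity of a linear character `χ` in a representation `ρ` of `G`: the dimension of
the space of vectors on which every `x` acts by the scalar `χ x`. -/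
noncomputable def linMultiplicity {G : Type*} [Group G] {κ : Type*} [Field κ] {V : Type*}
    [AddCommGroup V] [Module κ V] (ρ : Representation κ G V) (χ : G →* κˣ) : ℕ :=
  Module.finrank κ
    (⨅ x : G, Module.End.eigenspace (ρ x) (χ x : κ) : Submodule κ V)

end KacMultiplicity

/-! For a linear character χ, summing χ over a stabilizer gives its order or 0, so ⟨R, χ⟩ counts the
orbits whose stabilizers lie in ker χ (`charInner_card_fixedPoints`). It remains to show that, for α
of order n = ∑ v i, ρ is absolutely indecomposable iff 1^α is trivial on Aut ρ
(`isAbsIndecomposable_iff`).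

If ρ is absolutely indecomposable, Fitting's lemma over K̄ makes every automorphism g a scalar μ
plus a nilpotent. As n divides q - 1, it is invertible in K, so μ = tr(g)/n lies in K and 1^α(g) =
α(μ)^n = 1.

Conversely, let e be an endomorphism and C, of degree n, the product of the characteristic
polynomials of the e i. Write C = P^m Q with P irreducible, m > 0 and P ∤ Q. Surjectivity of the
norm from K[X]/P and the Chinese remainder theorem give, for each t in K^×, an automorphism h(e) of
total determinant t^m. Hence α^m = 1 and n ∣ m, while n = m deg P + deg Q, so P is linear and Q
constant: e is a scalar plus a nilpotent. The nilpotent endomorphisms then lie in a nilpotent ideal,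
so this shape survives base change and excludes non-trivial idempotents over K̄. -/

namespace KacMultiplicity

open Polynomial

/-! ### Determinants of polynomials in a matrix, and norms. -/

section Polynomials

/-- The determinant of a polynomial in `M` is the product of its values at the eigenvalues. -/
theorem det_aeval_eq_prod_roots {F : Type*} [Field F] [IsAlgClosed F] {n : Type*} [Fintype n]
    [DecidableEq n] (M : Matrix n n F) (h : F[X]) :
    (aeval M h).det = (M.charpoly.roots.map fun x => h.eval x).prod := by
  have hcard : M.charpoly.roots.card = Fintype.card n := by
    rw [← (IsAlgClosed.splits M.charpoly).natDegree_eq_card_roots, M.charpoly_natDegree_eq_dim]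
  -- Both sides are multiplicative in h, so linear factors and constants suffice.
  have hlin : ∀ μ : F, (aeval M (X - C μ)).det =
      (M.charpoly.roots.map fun x => (X - C μ).eval x).prod := by
    intro μ
    have h1 : (Matrix.scalar n μ - M).det = (M.charpoly.roots.map fun x => μ - x).prod := by
      rw [← Matrix.eval_charpoly]
      conv_lhs => rw [(IsAlgClosed.splits M.charpoly).eq_prod_roots]
      simp [M.charpoly_monic.leadingCoeff, eval_multiset_prod, Multiset.map_map]
    have h2 : aeval M (X - C μ) = -(Matrix.scalar n μ - M) := by
      simp [Algebra.algebraMap_eq_smul_one, Matrix.smul_one_eq_diagonal]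
    have h3 : (M.charpoly.roots.map fun x => (X - C μ).eval x) =
        (M.charpoly.roots.map fun x => μ - x).map Neg.neg := by
      simp [Multiset.map_map]
    rw [h2, Matrix.det_neg, h1, h3, Multiset.prod_map_neg, Multiset.card_map, hcard]
  have hmul : ∀ s : Multiset F, (aeval M (s.map fun μ => X - C μ).prod).det =
      (M.charpoly.roots.map fun x => ((s.map fun μ => X - C μ).prod).eval x).prod := by
    intro s
    induction s using Multiset.induction_on with
    | empty => simp
    | cons a s ih =>
      simp only [Multiset.map_cons, Multiset.prod_cons, map_mul, Matrix.det_mul, eval_mul,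
        Multiset.prod_map_mul, ih, hlin]
  conv_lhs => rw [(IsAlgClosed.splits h).eq_prod_roots]
  conv_rhs => rw [(IsAlgClosed.splits h).eq_prod_roots]
  rw [map_mul, Matrix.det_mul, hmul]
  simp only [eval_mul, Multiset.prod_map_mul]
  congr 1
  simp [hcard, Algebra.algebraMap_eq_smul_one]

theorem algebraMap_det_aeval {K F : Type*} [Field K] [Field F] [Algebra K F] [IsAlgClosed F]
    {n : Type*} [Fintype n] [DecidableEq n] (M : Matrix n n K) (h : K[X]) :
    algebraMap K F (aeval M h).det = ((M.charpoly.aroots F).map fun x => aeval x h).prod := by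
  have h1 : (algebraMap K F).mapMatrix (aeval M h) =
      aeval (M.map (algebraMap K F)) (h.map (algebraMap K F)) := by
    rw [aeval_map_algebraMap]
    exact (aeval_algHom_apply (Algebra.ofId K F).mapMatrix M h).symm
  rw [RingHom.map_det, h1, det_aeval_eq_prod_roots]
  have : (M.map (algebraMap K F)).charpoly = M.charpoly.map (algebraMap K F) :=
    Matrix.charpoly_map M (algebraMap K F)
  rw [this]
  simp [aroots, eval_map_algebraMap]

/-- Multiplication by the root of P has characteristic polynomial P, so the norm is the determinant
of h evaluated at that matrix. -/
theorem algebraMap_norm_mk {K F : Type*} [Field K] [Field F] [Algebra K F] [IsAlgClosed F]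
    {P : K[X]} (hP : P.Monic) [Fact (Irreducible P)] (h : K[X]) :
    algebraMap K F (Algebra.norm K (AdjoinRoot.mk P h)) =
      ((P.aroots F).map fun x => aeval x h).prod := by
  let pb := AdjoinRoot.powerBasis hP.ne_zero
  have hgen : pb.gen = AdjoinRoot.root P := AdjoinRoot.powerBasis_gen _
  have hmin : minpoly K pb.gen = P := by
    rw [hgen, AdjoinRoot.minpoly_root hP.ne_zero]; simp [hP.leadingCoeff]
  rw [Algebra.norm_eq_matrix_det pb.basis, ← AdjoinRoot.aeval_eq, ← hgen, ← aeval_algHom_apply,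
    algebraMap_det_aeval, charpoly_leftMulMatrix, hmin]

/-- If `C = P ^ m * Q` with `P` irreducible not dividing `Q`, then every `t` is such that `t ^ m`
is the product of the values of some polynomial at the roots of `C`. -/
theorem exists_prod_aroots_eq_pow {K : Type*} [Field K] [Finite K] (F : Type*) [Field F]
    [Algebra K F] [IsAlgClosed F] {P Q : K[X]} (hP : P.Monic) (hirr : Irreducible P)
    (hPQ : ¬ P ∣ Q) (m : ℕ) (t : K) :
    ∃ h : K[X], (((P ^ m * Q).aroots F).map fun x => aeval x h).prod =
      algebraMap K F (t ^ m) := by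
  have : Fact (Irreducible P) := ⟨hirr⟩
  let pb := AdjoinRoot.powerBasis hP.ne_zero
  have : Module.Finite K (AdjoinRoot P) := pb.finite
  have : Finite (AdjoinRoot P) := Module.finite_of_finite K
  obtain ⟨w, hw⟩ := FiniteField.norm_surjective K (AdjoinRoot P) t
  obtain ⟨h₀, rfl⟩ := AdjoinRoot.mk_surjective w
  obtain ⟨a, b, hab⟩ := (hirr.coprime_iff_not_dvd.2 hPQ : IsCoprime P Q)
  have hQ : Q ≠ 0 := fun h => hPQ (h ▸ dvd_zero P)
  -- Chinese remainder: since aP + bQ = 1, this is h₀ modulo P and 1 modulo Q.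
  refine ⟨h₀ * (b * Q) + a * P, ?_⟩
  have h1 : ((P.aroots F).map fun x => aeval x (h₀ * (b * Q) + a * P)) =
      (P.aroots F).map fun x => aeval x h₀ := by
    refine Multiset.map_congr rfl fun x hx => ?_
    have hx0 : aeval x P = 0 := ((mem_aroots.1 hx).2)
    have := congrArg (aeval x) hab
    simp only [map_add, map_mul, hx0, mul_zero, zero_add, map_one] at this ⊢
    rw [this]; ring
  have h2 : ((Q.aroots F).map fun x => aeval x (h₀ * (b * Q) + a * P)) =
      (Q.aroots F).map fun _ => 1 := by
    refine Multiset.map_congr rfl fun x hx => ?_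
    have hx0 : aeval x Q = 0 := ((mem_aroots.1 hx).2)
    have := congrArg (aeval x) hab
    simp only [map_add, map_mul, hx0, mul_zero, zero_add, add_zero, map_one] at this ⊢
    exact this
  rw [aroots_mul (mul_ne_zero (pow_ne_zero _ hP.ne_zero) hQ), aroots_pow, Multiset.map_add,
    Multiset.prod_add, h2, Multiset.map_nsmul, Multiset.prod_nsmul, h1,
    ← algebraMap_norm_mk hP, hw]
  simp

end Polynomials

/-! ### Nilpotent elements and the Jacobson radical. -/

section Radical

open scoped Pointwise

variable {R : Type*} [Ring R]

/-- A multiple y * a of a nilpotent a can be a unit only in the zero ring, so it is nilpotent and 1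
+ y * a is invertible. -/
theorem mem_jacobson_of_isNilpotent (h : ∀ a : R, IsNilpotent a ∨ IsUnit a) {a : R}
    (ha : IsNilpotent a) : a ∈ Ideal.jacobson (⊥ : Ideal R) := by
  rw [Ideal.mem_jacobson_iff]
  intro y
  have hu : IsUnit (1 + y * a) := by
    rcases h (y * a) with hn | hu
    · exact hn.isUnit_one_add
    · obtain ⟨k, hk⟩ := ha
      obtain ⟨u, hu⟩ := hu.exists_left_inv
      have h1 : (u * y) ^ k * a ^ k = 1 := pow_mul_pow_eq_one k (by rw [mul_assoc, hu])
      rw [hk, mul_zero] at h1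
      have := subsingleton_of_zero_eq_one h1
      exact isUnit_of_subsingleton _
  obtain ⟨z, hz⟩ := hu.exists_left_inv
  refine ⟨z, ?_⟩
  rw [mul_add, mul_one] at hz
  rw [Ideal.mem_bot, mul_assoc, ← hz]
  abel

/-- In an Artinian ring all of whose elements are units or nilpotent, linear combinations of
images of nilpotent elements in an algebra are nilpotent. -/
theorem isNilpotent_of_mem_span_image [IsArtinianRing R] (h : ∀ a : R, IsNilpotent a ∨ IsUnit a)
    {F B : Type*} [Field F] [Ring B] [Algebra F B] (f : R →+* B) {b : B}
    (hb : b ∈ Submodule.span F (f '' {a | IsNilpotent a})) : IsNilpotent b := by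
  obtain ⟨N, hN⟩ := IsArtinianRing.isNilpotent_jacobson_bot (R := R)
  refine ⟨N + 1, ?_⟩
  have h1 : ∀ n, ∀ x ∈ (f '' {a | IsNilpotent a}) ^ n,
      ∃ y ∈ (Ideal.jacobson (⊥ : Ideal R)) ^ n, f y = x := by
    intro n
    induction n with
    | zero =>
      intro x hx
      rw [pow_zero, Set.mem_one] at hx
      exact ⟨1, by simp [Submodule.pow_zero, Ideal.one_eq_top], by simp [hx]⟩
    | succ n ih =>
      intro x hx
      rw [pow_succ, Set.mem_mul] at hx
      obtain ⟨x₁, hx₁, x₂, ⟨a, ha, rfl⟩, rfl⟩ := hx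
      obtain ⟨y, hy, rfl⟩ := ih x₁ hx₁
      exact ⟨y * a, by
        rw [Submodule.pow_succ]; exact Ideal.mul_mem_mul hy (mem_jacobson_of_isNilpotent h ha),
        map_mul _ _ _⟩
  -- The N-th power of the span is spanned by images of N-fold products, which lie in the vanishing
  -- N-th power of the radical.
  have h2 := Submodule.pow_mem_pow _ hb N
  rw [Submodule.span_pow] at h2
  have h3 : (f '' {a | IsNilpotent a}) ^ N ⊆ {0} := by
    intro x hx
    obtain ⟨y, hy, rfl⟩ := h1 N x hx
    rw [hN] at hy
    rw [(Ideal.mem_bot.1 hy), map_zero]; rfl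
  have h4 := Submodule.span_mono h3 h2
  rw [Submodule.span_singleton_eq_bot.2 rfl, Submodule.mem_bot] at h4
  rw [pow_succ, h4, zero_mul]

end Radical

/-! ### Linear characters in permutation representations. -/

section Multiplicity

variable {G X κ : Type*} [Group G] [MulAction G X] [Field κ]

/-- The orbits on whose stabilizers the linear character `χ` is trivial. -/
def trivialStabilizerOrbits (X : Type*) [MulAction G X] (χ : G →* κˣ) :
    Set (MulAction.orbitRel.Quotient G X) :=
  {c | ∃ x : X, (∀ g : G, g • x = x → χ g = 1) ∧ Quotient.mk _ x = c}

theorem stabilizer_trivial_of_mk_eq (χ : G →* κˣ) {x y : X}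
    (h : (Quotient.mk (MulAction.orbitRel G X) x) = Quotient.mk _ y)
    (hx : ∀ g : G, g • x = x → χ g = 1) (g : G) (hg : g • y = y) : χ g = 1 := by
  obtain ⟨k, rfl⟩ := (MulAction.orbitRel_apply.1 (Quotient.exact h) : x ∈ MulAction.orbit G y)
  have h1 := hx (k * g * k⁻¹) (by simp [mul_smul, hg])
  simpa [mul_comm] using h1

theorem mk_mem_trivialStabilizerOrbits (χ : G →* κˣ) {x : X} :
    (Quotient.mk _ x : MulAction.orbitRel.Quotient G X) ∈ trivialStabilizerOrbits X χ ↔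
      ∀ g : G, g • x = x → χ g = 1 :=
  ⟨fun ⟨_, hy, h⟩ => stabilizer_trivial_of_mk_eq χ h hy, fun h => ⟨x, h, rfl⟩⟩

open Classical in
theorem sum_stabilizer_inv [Fintype G] (χ : G →* κˣ) (x : X) :
    ∑ g : G, (if g • x = x then (χ g⁻¹ : κ) else 0) =
      if ∀ g : G, g • x = x → χ g = 1 then (Nat.card (MulAction.stabilizer G x) : κ) else 0 := by
  let f : MulAction.stabilizer G x →* κ :=
    (Units.coeHom κ).comp (χ.comp (MulAction.stabilizer G x).subtype)
  have h1 : ∑ g : G, (if g • x = x then (χ g⁻¹ : κ) else 0) = ∑ g, f g := by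
    have h2 : ∀ g : G, (if g⁻¹ • x = x then (χ g⁻¹⁻¹ : κ) else 0) =
        if g ∈ MulAction.stabilizer G x then (χ g : κ) else 0 := by
      intro g
      have h3 : g⁻¹ • x = x ↔ g ∈ MulAction.stabilizer G x := by
        rw [inv_smul_eq_iff, MulAction.mem_stabilizer_iff, eq_comm]
      simp only [h3, inv_inv]
    rw [← Equiv.sum_comp (Equiv.inv G) (fun g => if g • x = x then (χ g⁻¹ : κ) else 0)]
    simp only [Equiv.inv_apply, h2]
    rw [← Finset.sum_filter, Finset.sum_subtype (p := fun g => g ∈ MulAction.stabilizer G x)]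
    · rfl
    · simp
  rw [h1, sum_hom_units]
  have h2 : f = 1 ↔ ∀ g : G, g • x = x → χ g = 1 := by
    rw [DFunLike.ext_iff]
    simp [f, Subtype.forall, MulAction.mem_stabilizer_iff]
  simp only [h2, Nat.card_eq_fintype_card]
  split_ifs <;> simp

-- By orbit-stabilizer, the stabilizer orders along one orbit add up to the order of G.
open Classical in
theorem sum_card_stabilizer [CharZero κ] [Fintype G] [Fintype X] (χ : G →* κˣ) :
    ∑ x : X, (if ∀ g : G, g • x = x → χ g = 1 then (Nat.card (MulAction.stabilizer G x) : κ)
      else 0) = Nat.card G * (trivialStabilizerOrbits X χ).ncard := by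
  have key : ∀ c : MulAction.orbitRel.Quotient G X,
      ∑ x with (Quotient.mk _ x : MulAction.orbitRel.Quotient G X) = c,
        (if ∀ g : G, g • x = x → χ g = 1 then (Nat.card (MulAction.stabilizer G x) : κ)
          else 0) = if c ∈ trivialStabilizerOrbits X χ then (Nat.card G : κ) else 0 := by
    intro c
    induction c using Quotient.inductionOn with | _ y
    have hcard : ∀ x : X, (Nat.card (MulAction.stabilizer G x) : κ) =
        Nat.card G / Nat.card (MulAction.orbit G x) := by
      intro x
      have : (Nat.card (MulAction.orbit G x) : κ) ≠ 0 := by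
        have : Nonempty (MulAction.orbit G x) := ⟨⟨x, MulAction.mem_orbit_self x⟩⟩
        exact Nat.cast_ne_zero.2 Nat.card_pos.ne'
      rw [eq_div_iff this, ← Nat.cast_mul, mul_comm, ← Nat.card_prod,
        Nat.card_congr (MulAction.orbitProdStabilizerEquivGroup G x)]
    have hterm : ∀ x ∈ Finset.univ.filter
        (fun x : X => (Quotient.mk _ x : MulAction.orbitRel.Quotient G X) = Quotient.mk _ y),
        (if ∀ g : G, g • x = x → χ g = 1 then (Nat.card (MulAction.stabilizer G x) : κ)
          else 0) = if (Quotient.mk _ y : MulAction.orbitRel.Quotient G X) ∈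
            trivialStabilizerOrbits X χ
            then (Nat.card G : κ) / Nat.card (MulAction.orbit G y) else 0 := by
      intro x hx
      have hxy := (Finset.mem_filter.1 hx).2
      rw [← hxy]
      simp only [mk_mem_trivialStabilizerOrbits, hcard]
      rw [MulAction.orbit_eq_iff.2 (MulAction.orbitRel_apply.1 (Quotient.exact hxy))]
    rw [Finset.sum_congr rfl hterm, Finset.sum_const]
    have hfib : (Finset.univ.filter (fun x : X =>
        (Quotient.mk _ x : MulAction.orbitRel.Quotient G X) = Quotient.mk _ y)).card =
        Nat.card (MulAction.orbit G y) := by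
      rw [Nat.card_eq_fintype_card, ← Set.toFinset_card]
      congr 1
      ext x
      simp only [Finset.mem_filter, Finset.mem_univ, true_and, Set.mem_toFinset]
      rw [← MulAction.orbitRel_apply]
      exact Quotient.eq
    have : (Nat.card (MulAction.orbit G y) : κ) ≠ 0 := by
      have : Nonempty (MulAction.orbit G y) := ⟨⟨y, MulAction.mem_orbit_self y⟩⟩
      exact Nat.cast_ne_zero.2 Nat.card_pos.ne'
    rw [hfib]
    split_ifs
    · rw [nsmul_eq_mul, mul_div_cancel₀ _ this]
    · simp
  rw [← Finset.sum_fiberwise Finset.univ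
    (fun x : X => (Quotient.mk _ x : MulAction.orbitRel.Quotient G X)),
    Finset.sum_congr rfl fun c _ => key c, ← Finset.sum_filter, Finset.sum_const, nsmul_eq_mul,
    mul_comm, Set.ncard_eq_toFinset_card']
  congr 3
  ext c
  simp

/-- The inner product of a permutation character with a linear character is the number of orbits
on whose stabilizers the linear character is trivial. -/
theorem charInner_card_fixedPoints [CharZero κ] [Finite G] [Finite X] (χ : G →* κˣ) :
    charInner (fun g : G => (Nat.card {x : X // g • x = x} : κ)) (fun g => (χ g : κ)) =
      (trivialStabilizerOrbits X χ).ncard := by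
  classical
  have := Fintype.ofFinite G
  have := Fintype.ofFinite X
  have h0 : (Nat.card G : κ) ≠ 0 := Nat.cast_ne_zero.2 Nat.card_pos.ne'
  rw [charInner, finsum_eq_sum_of_fintype, inv_mul_eq_iff_eq_mul₀ h0, ← sum_card_stabilizer]
  simp only [← sum_stabilizer_inv]
  rw [Finset.sum_comm]
  refine Finset.sum_congr rfl fun g _ => ?_
  rw [← Finset.sum_filter, Finset.sum_const, nsmul_eq_mul, Nat.card_eq_fintype_card,
    Fintype.card_subtype]

theorem trace_ofMulAction [Finite X] (g : G) :
    LinearMap.trace κ (MonoidAlgebra κ X) (Representation.ofMulAction κ G X g) =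
      (Nat.card {x : X // g • x = x} : κ) := by
  classical
  have := Fintype.ofFinite X
  rw [LinearMap.trace_eq_matrix_trace κ
    (Module.Basis.ofRepr (MonoidAlgebra.coeffLinearEquiv κ (M := X))), Matrix.trace,
    Nat.card_eq_fintype_card, Fintype.card_subtype, Finset.card_filter]
  push_cast
  refine Finset.sum_congr rfl fun x _ => ?_
  rw [Matrix.diag_apply, LinearMap.toMatrix_apply]
  simp [Representation.ofMulAction_single, Finsupp.single_apply, Module.Basis.coe_ofRepr]

/-- The multiplicity of a linear character is its inner product with the character of the
representation. -/
theorem charInner_trace [CharZero κ] [Finite G] {V : Type*} [AddCommGroup V] [Module κ V]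
    [FiniteDimensional κ V] (ρ : Representation κ G V) (χ : G →* κˣ) :
    charInner (fun g => LinearMap.trace κ V (ρ g)) (fun g => (χ g : κ)) =
      (linMultiplicity ρ χ : κ) := by
  classical
  have := Fintype.ofFinite G
  have h0 : (Nat.card G : κ) ≠ 0 := Nat.cast_ne_zero.2 Nat.card_pos.ne'
  -- The averaging projector onto the χ-isotypic subspace: its trace is both the inner product and
  -- the dimension of its image.
  let π : V →ₗ[κ] V := (Nat.card G : κ)⁻¹ • ∑ g : G, (χ g⁻¹ : κ) • ρ g
  have hπ : LinearMap.IsProj (⨅ x : G, Module.End.eigenspace (ρ x) (χ x : κ) : Submodule κ V)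
      π := by
    constructor
    · intro y
      rw [Submodule.mem_iInf]
      intro x
      rw [Module.End.mem_eigenspace_iff]
      simp only [π, LinearMap.smul_apply, LinearMap.sum_apply, map_smul, map_sum]
      rw [smul_comm]
      congr 1
      rw [Finset.smul_sum, ← Equiv.sum_comp (Equiv.mulLeft x) (fun g => (χ x : κ) • (χ g⁻¹ : κ) • ρ g y)]
      refine Finset.sum_congr rfl fun g _ => ?_
      rw [smul_smul, ← Units.val_mul, ← map_mul]
      simp
    · intro y hy
      rw [Submodule.mem_iInf] at hy
      have : ∀ g : G, ((χ g⁻¹ : κ) • ρ g) y = y := by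
        intro g
        rw [LinearMap.smul_apply, Module.End.mem_eigenspace_iff.1 (hy g), smul_smul,
          ← Units.val_mul, ← map_mul]
        simp
      simp only [π, LinearMap.smul_apply, LinearMap.sum_apply]
      simp only [← LinearMap.smul_apply, this]
      rw [Finset.sum_const, Finset.card_univ, ← Nat.card_eq_fintype_card, ← Nat.cast_smul_eq_nsmul κ,
        smul_smul, inv_mul_cancel₀ h0, one_smul]
  rw [linMultiplicity, ← hπ.trace, charInner, finsum_eq_sum_of_fintype]
  simp [π, mul_comm]

end Multiplicity

/-! ### Determinant and trace of a scalar plus a nilpotent. -/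

section Nilpotent

variable {F : Type*} [Field F] {n : Type*} [Fintype n] [DecidableEq n]

theorem det_eq_pow_of_isNilpotent_sub {M : Matrix n n F} {μ : F}
    (h : IsNilpotent (M - algebraMap F _ μ)) : M.det = μ ^ Fintype.card n := by
  have h1 : (M - algebraMap F _ μ).charpoly = X ^ Fintype.card n :=
    sub_eq_zero.1 (Matrix.isNilpotent_charpoly_sub_pow_of_isNilpotent h).eq_zero
  have h2 := Matrix.eval_charpoly (M - algebraMap F _ μ) (-μ)
  have h3 : Matrix.scalar n (-μ) - (M - algebraMap F _ μ) = -M := by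
    rw [map_neg]
    have : algebraMap F (Matrix n n F) μ = Matrix.scalar n μ := rfl
    rw [this]; abel
  rw [h1, h3, Matrix.det_neg, eval_pow, eval_X, neg_pow] at h2
  exact (mul_left_cancel₀ (pow_ne_zero _ (by simp)) h2).symm

theorem trace_eq_mul_of_isNilpotent_sub {M : Matrix n n F} {μ : F}
    (h : IsNilpotent (M - algebraMap F _ μ)) : M.trace = Fintype.card n * μ := by
  have h1 := (Matrix.isNilpotent_trace_of_isNilpotent h).eq_zero
  rw [Matrix.trace_sub, sub_eq_zero] at h1
  rw [h1, Algebra.algebraMap_eq_smul_one, Matrix.trace_smul, Matrix.trace_one, smul_eq_mul,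
    mul_comm]

end Nilpotent

/-! ### Endomorphism algebras, Fitting's lemma and idempotents. -/

section Endomorphisms

variable {I : Type*} [Quiver I] {v : I → ℕ} {K : Type*} [Field K]

/-- The algebra of endomorphisms of a representation. -/
def QuiverRep.endAlgebra (ρ : QuiverRep I v K) :
    Subalgebra K (∀ i, Matrix (Fin (v i)) (Fin (v i)) K) where
  carrier := {e | ∀ (i j : I) (a : i ⟶ j), e j * ρ i j a = ρ i j a * e i}
  mul_mem' {e f} he hf i j a := by
    rw [Pi.mul_apply, Pi.mul_apply, Matrix.mul_assoc, hf, ← Matrix.mul_assoc, he,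
      Matrix.mul_assoc]
  add_mem' {e f} he hf i j a := by
    rw [Pi.add_apply, Pi.add_apply, Matrix.add_mul, Matrix.mul_add, he, hf]
  algebraMap_mem' c i j a := by
    simp [Pi.algebraMap_apply, Algebra.algebraMap_eq_smul_one]

theorem QuiverRep.mem_endAlgebra {ρ : QuiverRep I v K}
    {e : ∀ i, Matrix (Fin (v i)) (Fin (v i)) K} :
    e ∈ ρ.endAlgebra ↔ ∀ (i j : I) (a : i ⟶ j), e j * ρ i j a = ρ i j a * e i := Iff.rfl

theorem smul_eq_iff_mem_endAlgebra (ρ : QuiverRep I v K) (g : GLv v K) :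
    g • ρ = ρ ↔ (fun i => (g i).val) ∈ ρ.endAlgebra := by
  rw [QuiverRep.mem_endAlgebra]
  constructor
  · intro h i j a
    have h1 : (g j).val * ρ i j a * ((g i)⁻¹).val = ρ i j a := by
      rw [← smul_apply, h]
    conv_rhs => rw [← h1]
    rw [Matrix.mul_assoc _ ((g i)⁻¹).val, ← Units.val_mul, inv_mul_cancel, Units.val_one,
      Matrix.mul_one]
  · intro h
    funext i j a
    rw [smul_apply, h, Matrix.mul_assoc, ← Units.val_mul, mul_inv_cancel, Units.val_one,
      Matrix.mul_one]

/-- Fitting's lemma for representations: an endomorphism of an indecomposable representation over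
an algebraically closed field is the sum of a scalar and a nilpotent endomorphism. -/
theorem QuiverRep.IsIndecomposable.exists_isNilpotent_sub [Finite I] [IsAlgClosed K]
    {ρ : QuiverRep I v K} (hρ : ρ.IsIndecomposable) {e : ∀ i, Matrix (Fin (v i)) (Fin (v i)) K}
    (he : e ∈ ρ.endAlgebra) :
    ∃ μ : K, ∀ i, IsNilpotent (e i - algebraMap K _ μ) := by
  obtain ⟨hv, hdec⟩ := hρ
  obtain ⟨i₀, hi₀⟩ := Function.ne_iff.1 hv
  have : Nonempty (Fin (v i₀)) := ⟨⟨0, Nat.pos_of_ne_zero hi₀⟩⟩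
  -- An eigenvalue at a single vertex suffices: it makes the Fitting kernel of e - μ non-zero there,
  -- so indecomposability kills the Fitting range at all vertices.
  obtain ⟨μ, hμ⟩ := Module.End.exists_eigenvalue (Matrix.mulVecLin (e i₀))
  obtain ⟨x, hx⟩ := hμ.exists_hasEigenvector
  refine ⟨μ, ?_⟩
  set d : ∀ i, Matrix (Fin (v i)) (Fin (v i)) K := fun i => e i - algebraMap K _ μ with hd
  have hdmem : d ∈ ρ.endAlgebra := sub_mem he (ρ.endAlgebra.algebraMap_mem μ)
  have hcompl := Filter.eventually_all.2 fun i =>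
    LinearMap.eventually_isCompl_ker_pow_range_pow (Matrix.mulVecLin (d i))
  -- One exponent serves all vertices because I is finite; N ≥ 1 puts the eigenvector into the
  -- kernel of the power.
  obtain ⟨N, hN, hN1⟩ := (hcompl.and (Filter.eventually_ge_atTop 1)).exists
  have hpow : ∀ i, (Matrix.mulVecLin (d i)) ^ N = Matrix.mulVecLin (d i ^ N) := fun i => by
    exact (Matrix.toLin'_pow (d i) N).symm
  simp only [hpow] at hN
  have hcomm : ∀ (i j : I) (a : i ⟶ j), d j ^ N * ρ i j a = ρ i j a * d i ^ N :=
    QuiverRep.mem_endAlgebra.1 (pow_mem hdmem N)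
  have hker : ρ.IsSubrep fun i => LinearMap.ker (Matrix.mulVecLin (d i ^ N)) := by
    intro i j a x hx
    rw [LinearMap.mem_ker, Matrix.mulVecLin_apply] at hx ⊢
    rw [Matrix.mulVec_mulVec, hcomm, ← Matrix.mulVec_mulVec, hx, Matrix.mulVec_zero]
  have hrange : ρ.IsSubrep fun i => LinearMap.range (Matrix.mulVecLin (d i ^ N)) := by
    rintro i j a _ ⟨y, rfl⟩
    refine ⟨(ρ i j a).mulVec y, ?_⟩
    simp only [Matrix.mulVecLin_apply, Matrix.mulVec_mulVec, hcomm]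
  rcases hdec _ _ hker hrange hN with h | h
  · exfalso
    refine hx.2 ((Submodule.mem_bot K).1 (h i₀ ▸ ?_))
    have hx1 : (d i₀).mulVec x = 0 := by
      have := hx.apply_eq_smul
      rw [Matrix.mulVecLin_apply] at this
      simp [hd, Matrix.sub_mulVec, this, Algebra.algebraMap_eq_smul_one, Matrix.smul_mulVec]
    obtain ⟨N', rfl⟩ := Nat.exists_eq_add_of_le' hN1
    rw [LinearMap.mem_ker, Matrix.mulVecLin_apply, pow_succ, ← Matrix.mulVec_mulVec, hx1,
      Matrix.mulVec_zero]
  · intro i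
    refine ⟨N, ?_⟩
    have h1 := LinearMap.range_eq_bot.1 (h i)
    exact (map_eq_zero_iff _ (Matrix.toLin').injective).1 h1

/-- A non-zero representation without non-trivial idempotent endomorphisms is indecomposable. -/
theorem QuiverRep.isIndecomposable_of_idempotents {ρ : QuiverRep I v K} (hv : v ≠ 0)
    (h : ∀ e ∈ ρ.endAlgebra, IsIdempotentElem e → e = 0 ∨ e = 1) : ρ.IsIndecomposable := by
  refine ⟨hv, fun U W hU hW hUW => ?_⟩
  let e : ∀ i, Matrix (Fin (v i)) (Fin (v i)) K := fun i =>
    LinearMap.toMatrix' ((U i).projection (W i) (hUW i))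
  have he : ∀ i x, (e i).mulVec x = (U i).projection (W i) (hUW i) x := fun i x => by
    rw [← Matrix.toLin'_apply, Matrix.toLin'_toMatrix']
  have hmem : e ∈ ρ.endAlgebra := by
    intro i j a
    refine Matrix.toLin'.injective (LinearMap.ext fun x => ?_)
    simp only [Matrix.toLin'_apply, ← Matrix.mulVec_mulVec, he]
    obtain ⟨u, hu, w, hw, rfl⟩ := Submodule.mem_sup.1
      ((hUW i).sup_eq_top ▸ Submodule.mem_top : x ∈ U i ⊔ W i)
    rw [Matrix.mulVec_add, map_add, map_add,
      (Submodule.projection_eq_self_iff (hUW i) u).2 hu,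
      (Submodule.projection_apply_eq_zero_iff (hUW i)).2 hw,
      (Submodule.projection_eq_self_iff (hUW j) _).2 (hU i j a u hu),
      (Submodule.projection_apply_eq_zero_iff (hUW j)).2 (hW i j a w hw), add_zero,
      add_zero]
  have hidem : IsIdempotentElem e := by
    funext i
    change e i * e i = e i
    rw [← LinearMap.toMatrix'_mul]
    exact congrArg _ (Submodule.isIdempotentElem_projection (hUW i))
  rcases h e hmem hidem with h0 | h1
  · left
    intro i
    rw [eq_bot_iff]
    intro x hx
    rw [Submodule.mem_bot, ← (Submodule.projection_eq_self_iff (hUW i) x).2 hx, ← he, h0]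
    simp
  · right
    intro i
    rw [eq_bot_iff]
    intro x hx
    have := (Submodule.projection_apply_eq_zero_iff (hUW i)).2 hx
    rw [← he, h1] at this
    simpa using this

/-- The equations defining endomorphisms have coefficients in K, so they pass to coordinates. This
writes endomorphisms over F as F-combinations of endomorphisms over K. -/
theorem coord_mem_endAlgebra {ρ : QuiverRep I v K} {F : Type*} [Field F] [Algebra K F]
    (φ : F →ₗ[K] K) {e : ∀ i, Matrix (Fin (v i)) (Fin (v i)) F}
    (he : e ∈ (ρ.baseChange F).endAlgebra) : (fun i => (e i).map φ) ∈ ρ.endAlgebra := by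
  intro i j a
  have h := congrArg (fun M => M.map φ) (QuiverRep.mem_endAlgebra.1 he i j a)
  ext s t
  have h1 := congrFun (congrFun h s) t
  simp only [QuiverRep.baseChange, Matrix.map_apply, Matrix.mul_apply, map_sum] at h1 ⊢
  have h2 : ∀ (x : F) (c : K), φ (x * algebraMap K F c) = φ x * c := fun x c => by
    rw [mul_comm, ← Algebra.smul_def, map_smul, smul_eq_mul, mul_comm]
  have h3 : ∀ (x : F) (c : K), φ (algebraMap K F c * x) = c * φ x := fun x c => by
    rw [← Algebra.smul_def, map_smul, smul_eq_mul]
  simpa only [h2, h3] using h1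

end Endomorphisms

theorem linChar_apply {I : Type*} [Fintype I] {v : I → ℕ} {K κ : Type*} [Field K] [Field κ]
    (α : Kˣ →* κˣ) (g : GLv v K) :
    linChar v α g = ∏ i, α (Matrix.GeneralLinearGroup.det (g i)) := rfl

theorem pi_aeval_apply {I K : Type*} [CommSemiring K] {A : I → Type*} [∀ i, Semiring (A i)]
    [∀ i, Algebra K (A i)] (e : ∀ i, A i) (h : K[X]) (i : I) : aeval e h i = aeval (e i) h :=
  (aeval_algHom_apply (Pi.evalAlgHom K A i) e h).symm

/-- The order n divides q - 1, and q = 0 in K, so n = 0 in K would give 1 = 0. -/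
theorem natCast_ne_zero_of_orderOf_eq {K κ : Type*} [Field K] [Finite K] [Field κ]
    {α : Kˣ →* κˣ} {n : ℕ} (hα : orderOf α = n) : (n : K) ≠ 0 := by
  intro h0
  have hdvd : n ∣ Nat.card Kˣ := by
    rw [← hα, orderOf_dvd_iff_pow_eq_one]
    ext1 x
    rw [MonoidHom.pow_apply, ← map_pow, pow_card_eq_one', map_one, MonoidHom.one_apply]
  have := Fintype.ofFinite K
  obtain ⟨k, hk⟩ := hdvd
  have h1 : Nat.card K = Nat.card Kˣ + 1 := by
    rw [Nat.card_units, Nat.sub_add_cancel Nat.card_pos]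
  have h2 : (Nat.card K : K) = 0 := by
    rw [Nat.card_eq_fintype_card, FiniteField.cast_card_eq_zero]
  rw [h1, hk] at h2
  simp [h0] at h2

/-! ### Absolute indecomposability read off from 1^α on automorphisms. -/

section Criterion

variable {I : Type*} [Fintype I] [Quiver I] {v : I → ℕ} {K : Type*} [Field K] [Finite K]
  {κ : Type*} [Field κ] {α : Kˣ →* κˣ}

theorem linChar_eq_one_of_isAbsIndecomposable (hα : orderOf α = ∑ i, v i)
    {ρ : QuiverRep I v K} (hρ : ρ.IsAbsIndecomposable) (g : GLv v K) (hg : g • ρ = ρ) :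
    linChar v α g = 1 := by
  let F := AlgebraicClosure K
  have hinj := (algebraMap K F).injective
  have hmem : (fun i => (g i).val.map (algebraMap K F)) ∈ (ρ.baseChange F).endAlgebra := by
    intro i j a
    have h := (smul_eq_iff_mem_endAlgebra ρ g).1 hg i j a
    simp only [QuiverRep.baseChange, ← Matrix.map_mul, h]
  obtain ⟨μ, hμ⟩ := QuiverRep.IsIndecomposable.exists_isNilpotent_sub hρ hmem
  have hn : ((∑ i, v i : ℕ) : K) ≠ 0 := natCast_ne_zero_of_orderOf_eq hα
  -- The scalar descends to K, being the total trace divided by n.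
  have hμK : algebraMap K F (((∑ i, v i : ℕ) : K)⁻¹ * ∑ i, (g i).val.trace) = μ := by
    have h1 : ∑ i, algebraMap K F (g i).val.trace = ((∑ i, v i : ℕ) : F) * μ := by
      rw [Nat.cast_sum, Finset.sum_mul]
      refine Finset.sum_congr rfl fun i _ => ?_
      have := trace_eq_mul_of_isNilpotent_sub (hμ i)
      rw [Fintype.card_fin] at this
      rw [← this]
      exact AddMonoidHom.map_trace (algebraMap K F) _
    rw [map_mul, map_sum, h1, map_inv₀, map_natCast, inv_mul_cancel_left₀]
    rw [← map_natCast (algebraMap K F)]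
    exact (_root_.map_ne_zero _).2 hn
  obtain ⟨l, rfl⟩ : ∃ l, algebraMap K F l = μ := ⟨_, hμK⟩
  have hdet : ∀ i, (g i).val.det = l ^ v i := by
    intro i
    have := det_eq_pow_of_isNilpotent_sub (hμ i)
    rw [Fintype.card_fin, ← map_pow] at this
    apply hinj
    rw [← this]
    exact RingHom.map_det (algebraMap K F) _
  obtain ⟨i₀, hi₀⟩ := Function.ne_iff.1 hρ.1
  have hl : l ≠ 0 := by
    rintro rfl
    have h1 := hdet i₀
    rw [zero_pow hi₀] at h1
    exact (Matrix.GeneralLinearGroup.det (g i₀)).ne_zero h1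
  have hdet' : ∀ i, Matrix.GeneralLinearGroup.det (g i) = Units.mk0 l hl ^ v i := fun i =>
    Units.ext (by simpa using hdet i)
  rw [linChar_apply]
  simp only [hdet', map_pow]
  rw [Finset.prod_pow_eq_pow_sum, ← hα, ← MonoidHom.pow_apply, pow_orderOf_eq_one,
    MonoidHom.one_apply]

/-- If `1^α` is trivial on the automorphisms of `ρ`, then every endomorphism of `ρ` is the sum of
a scalar and a nilpotent endomorphism. -/
theorem exists_isNilpotent_sub_of_linChar (hv : v ≠ 0) (hα : orderOf α = ∑ i, v i)
    {ρ : QuiverRep I v K} (hρ : ∀ g : GLv v K, g • ρ = ρ → linChar v α g = 1)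
    {e : ∀ i, Matrix (Fin (v i)) (Fin (v i)) K} (he : e ∈ ρ.endAlgebra) :
    ∃ μ : K, IsNilpotent (e - algebraMap K _ μ) := by
  let F := AlgebraicClosure K
  have hinj := (algebraMap K F).injective
  set C : K[X] := ∏ i, (e i).charpoly with hC
  have hCmonic : C.Monic := monic_prod_of_monic _ _ fun i _ => (e i).charpoly_monic
  have hCdeg : C.natDegree = ∑ i, v i := by
    rw [hC, natDegree_prod_of_monic _ _ fun i _ => (e i).charpoly_monic]
    simp [Matrix.charpoly_natDegree_eq_dim]
  have hpos : 0 < ∑ i, v i := by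
    obtain ⟨i₀, hi₀⟩ := Function.ne_iff.1 hv
    exact (Nat.pos_of_ne_zero hi₀).trans_le
      (Finset.single_le_sum (f := v) (fun _ _ => Nat.zero_le _) (Finset.mem_univ i₀))
  have hCunit : ¬ IsUnit C := fun h => by
    have := natDegree_eq_zero_of_isUnit h
    omega
  obtain ⟨P, hPmonic, hPirr, hPC⟩ := exists_monic_irreducible_factor C hCunit
  obtain ⟨Q, hCPQ, hPQ⟩ :=
    (FiniteMultiplicity.of_not_isUnit hPirr.not_isUnit
      hCmonic.ne_zero).exists_eq_pow_mul_and_not_dvd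
  generalize multiplicity P C = m at hCPQ
  have hm : m ≠ 0 := by
    rintro rfl
    rw [pow_zero, one_mul] at hCPQ
    exact hPQ (hCPQ ▸ hPC)
  have hQ : Q ≠ 0 := fun h => hPQ (h ▸ dvd_zero P)
  have hαm : α ^ m = 1 := by
    ext1 t
    obtain ⟨h, hh⟩ := exists_prod_aroots_eq_pow F hPmonic hPirr hPQ m (t : K)
    have hprod : ∏ i, (aeval (e i) h).det = (t : K) ^ m := by
      apply hinj
      rw [← hh, ← hCPQ, hC, map_prod, aroots_def, Polynomial.map_prod,
        roots_prod _ _ (Finset.prod_ne_zero_iff.2 fun i _ =>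
          ((e i).charpoly_monic.map (algebraMap K F)).ne_zero), Multiset.map_bind,
        Multiset.prod_bind]
      exact Finset.prod_congr rfl fun i _ => algebraMap_det_aeval (F := F) (e i) h
    have hunit : ∀ i, IsUnit (aeval (e i) h).det := fun i => by
      have : IsUnit (∏ i, (aeval (e i) h).det) := hprod ▸ (t.isUnit.pow m)
      exact isUnit_of_dvd_unit (Finset.dvd_prod_of_mem (fun i => (aeval (e i) h).det)
        (Finset.mem_univ i)) this
    let g : GLv v K := fun i => Matrix.GeneralLinearGroup.mk'' (aeval (e i) h) (hunit i)
    have hg : g • ρ = ρ := by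
      rw [smul_eq_iff_mem_endAlgebra]
      have h1 : (fun i => (g i).val) = aeval e h := funext fun i => (pi_aeval_apply e h i).symm
      rw [h1]
      exact Algebra.adjoin_le (Set.singleton_subset_iff.2 he) (aeval_mem_adjoin_singleton K e)
    have h1 := hρ g hg
    rw [linChar_apply, ← map_prod] at h1
    have h2 : ∏ i, Matrix.GeneralLinearGroup.det (g i) = t ^ m := by
      apply Units.ext
      rw [Units.coe_prod, Units.val_pow_eq_pow_val, ← hprod]
      rfl
    rw [MonoidHom.pow_apply, ← map_pow, ← h2, h1, MonoidHom.one_apply]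
  have hdvd : ∑ i, v i ∣ m := hα ▸ orderOf_dvd_of_pow_eq_one hαm
  have hle : ∑ i, v i ≤ m := Nat.le_of_dvd (Nat.pos_of_ne_zero hm) hdvd
  have hdeg : m * P.natDegree + Q.natDegree = ∑ i, v i := by
    rw [← hCdeg, hCPQ, natDegree_mul (pow_ne_zero _ hPmonic.ne_zero) hQ, natDegree_pow]
  have hPdeg : 0 < P.natDegree := hPirr.natDegree_pos
  -- Combines n ≤ m with m deg P + deg Q = n.
  have hP1 : P.natDegree = 1 := by nlinarith
  have hQ0 : Q.natDegree = 0 := by rw [hP1] at hdeg; omega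
  have hQunit : IsUnit Q := isUnit_iff_degree_eq_zero.2 (by
    rw [degree_eq_natDegree hQ, hQ0]; rfl)
  refine ⟨-P.coeff 0, m, ?_⟩
  have hPX : aeval e P = e - algebraMap K _ (-P.coeff 0) := by
    conv_lhs => rw [hPmonic.eq_X_add_C hP1]
    rw [map_add, aeval_X, aeval_C, map_neg, sub_neg_eq_add]
  -- Cayley–Hamilton at each vertex: C contains the characteristic polynomial of e i as a factor.
  have hCe : aeval e C = 0 := by
    classical
    funext i
    rw [pi_aeval_apply, Pi.zero_apply, hC, ← Finset.mul_prod_erase _ _ (Finset.mem_univ i),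
      map_mul, Matrix.aeval_self_charpoly, zero_mul]
  rw [hCPQ, map_mul, map_pow, hPX] at hCe
  exact (hQunit.map (aeval e)).mul_left_eq_zero.1 hCe

/-- A representation is absolutely indecomposable when all its endomorphisms are sums of a scalar
and a nilpotent endomorphism. -/
theorem isIndecomposable_baseChange (hv : v ≠ 0) {ρ : QuiverRep I v K}
    (hρ : ∀ e ∈ ρ.endAlgebra, ∃ μ : K, IsNilpotent (e - algebraMap K _ μ))
    (F : Type*) [Field F] [Algebra K F] : (ρ.baseChange F).IsIndecomposable := by
  refine QuiverRep.isIndecomposable_of_idempotents hv fun e he hidem => ?_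
  let f : ρ.endAlgebra →+* (∀ i, Matrix (Fin (v i)) (Fin (v i)) F) :=
    (RingHom.pi fun i => (algebraMap K F).mapMatrix.comp (Pi.evalRingHom _ i)).comp
      ρ.endAlgebra.toSubring.subtype
  have hf : ∀ (x : ρ.endAlgebra) i s t, f x i s t = algebraMap K F (x.1 i s t) :=
    fun _ _ _ _ => rfl
  have hloc : ∀ x : ρ.endAlgebra, ∃ μ : K, IsNilpotent (x - algebraMap K _ μ) := by
    rintro ⟨x, hx⟩
    obtain ⟨μ, N, hN⟩ := hρ x hx
    exact ⟨μ, N, Subtype.ext (by simpa using hN)⟩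
  have hnu : ∀ x : ρ.endAlgebra, IsNilpotent x ∨ IsUnit x := by
    intro x
    obtain ⟨μ, hμ⟩ := hloc x
    by_cases h0 : μ = 0
    · left; simpa [h0] using hμ
    · right
      have hu : IsUnit (algebraMap K ρ.endAlgebra μ) := (IsUnit.mk0 μ h0).map _
      have := hμ.isUnit_add_right_of_commute hu (Algebra.commutes μ _).symm
      simpa using this
  -- Finiteness makes the endomorphism algebra Artinian, as the radical argument requires.
  have : Finite ρ.endAlgebra := Subtype.finite
  obtain ⟨Λ, hΛ⟩ : ∃ Λ : F, e - algebraMap F _ Λ ∈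
      Submodule.span F (f '' {a | IsNilpotent a}) := by
    let b := Module.Basis.ofVectorSpace K F
    have hce : ∀ k, (fun i => (e i).map (b.coord k)) ∈ ρ.endAlgebra := fun k =>
      coord_mem_endAlgebra (b.coord k) he
    choose μ hμ using fun k => hloc ⟨_, hce k⟩
    classical
    -- The finitely many basis vectors of F over K that occur in entries of e.
    let S : Finset _ := Finset.univ.biUnion fun i =>
      Finset.univ.biUnion fun st : Fin (v i) × Fin (v i) => (b.repr (e i st.1 st.2)).support
    have hsum : e = ∑ k ∈ S, b k • f ⟨_, hce k⟩ := by
      funext i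
      ext s t
      rw [Finset.sum_apply, Matrix.sum_apply]
      have h1 : (b.repr (e i s t)).support ⊆ S := fun k hk =>
        Finset.mem_biUnion.2 ⟨i, Finset.mem_univ _,
          Finset.mem_biUnion.2 ⟨(s, t), Finset.mem_univ _, hk⟩⟩
      conv_lhs => rw [← b.linearCombination_repr (e i s t), Finsupp.linearCombination_apply,
        Finsupp.sum_of_support_subset _ h1 (fun k c => c • b k) (fun k _ => zero_smul K (b k))]
      refine Finset.sum_congr rfl fun k _ => ?_
      rw [Pi.smul_apply, Matrix.smul_apply, hf, Algebra.smul_def, smul_eq_mul, mul_comm]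
      rfl
    refine ⟨∑ k ∈ S, b k * algebraMap K F (μ k), ?_⟩
    have h2 : e - algebraMap F _ (∑ k ∈ S, b k * algebraMap K F (μ k)) =
        ∑ k ∈ S, b k • f (⟨_, hce k⟩ - algebraMap K _ (μ k)) := by
      conv_lhs => rw [hsum]
      rw [map_sum, ← Finset.sum_sub_distrib]
      refine Finset.sum_congr rfl fun k _ => ?_
      rw [map_sub, smul_sub, map_mul, ← Algebra.smul_def]
      congr 2
      funext i
      ext s t
      rw [hf]
      simp only [Pi.algebraMap_apply, Matrix.algebraMap_matrix_apply, Subalgebra.coe_algebraMap,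
        Algebra.algebraMap_self, RingHom.id_apply]
      split_ifs <;> simp
    rw [h2]
    exact Submodule.sum_mem _ fun k _ => Submodule.smul_mem _ _
      (Submodule.subset_span ⟨_, hμ k, rfl⟩)
  have hnil := isNilpotent_of_mem_span_image hnu f hΛ
  -- The idempotent e is Λ plus a nilpotent: it is nilpotent, hence 0, or invertible, hence 1.
  by_cases h0 : Λ = 0
  · left
    rw [h0, map_zero, sub_zero] at hnil
    obtain ⟨N, hN⟩ := hnil
    rw [← hidem.pow_succ_eq N, pow_succ, hN, zero_mul]
  · right
    have hu : IsUnit (algebraMap F (∀ i, Matrix (Fin (v i)) (Fin (v i)) F) Λ) :=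
      (IsUnit.mk0 Λ h0).map _
    have h1 := hnil.isUnit_add_right_of_commute hu (Algebra.commutes Λ _).symm
    rw [sub_add_cancel] at h1
    exact h1.mul_left_cancel (hidem.trans (mul_one e).symm)

theorem isAbsIndecomposable_iff (hv : v ≠ 0) (hα : orderOf α = ∑ i, v i)
    (ρ : QuiverRep I v K) :
    ρ.IsAbsIndecomposable ↔ ∀ g : GLv v K, g • ρ = ρ → linChar v α g = 1 :=
  ⟨linChar_eq_one_of_isAbsIndecomposable hα, fun h => isIndecomposable_baseChange hv
    (fun _ he => exists_isNilpotent_sub_of_linChar hv hα h he) _⟩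

instance [∀ i j : I, Finite (i ⟶ j)] : Finite (QuiverRep I v K) :=
  inferInstanceAs (Finite (∀ (i j : I), (i ⟶ j) → Matrix (Fin (v j)) (Fin (v i)) K))

end Criterion

end KacMultiplicity

/-! ### Assembly of the three equalities. -/

theorem mainTheorem4 {I : Type*} [Fintype I] [Quiver I] [∀ i j : I, Finite (i ⟶ j)]
    (v : I → ℕ) (hv : v ≠ 0)
    {K : Type w} [Field K] [Finite K]
    {κ : Type*} [Field κ] [IsAlgClosed κ] [CharZero κ]
    (α : Kˣ →* κˣ) (hα : orderOf α = ∑ i, v i) :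
    -- the number `A_v(q)`, as a count of absolutely indecomposable representations over `K`
    (KacMultiplicity.numAbsIndecomposable I v K : κ) =
      KacMultiplicity.charInner (KacMultiplicity.permChar I v K κ)
        (fun g => (KacMultiplicity.linChar v α g : κ)) ∧
    -- the Kac polynomial, evaluated at `q`
    (∀ A : Polynomial ℚ, KacMultiplicity.IsKacPolynomial.{w} I v A →
      ((A.eval (Nat.card K : ℚ) : ℚ) : κ) =
        KacMultiplicity.charInner (KacMultiplicity.permChar I v K κ)
          (fun g => (KacMultiplicity.linChar v α g : κ))) ∧
    -- the inner product is the multiplicity of `1^α` in the permutation representation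
    KacMultiplicity.charInner (KacMultiplicity.permChar I v K κ)
        (fun g => (KacMultiplicity.linChar v α g : κ)) =
      (KacMultiplicity.linMultiplicity
        (Representation.ofMulAction κ (KacMultiplicity.GLv v K)
          (KacMultiplicity.QuiverRep I v K))
        (KacMultiplicity.linChar v α) : κ) := by
  have h1 : (KacMultiplicity.numAbsIndecomposable I v K : κ) =
      KacMultiplicity.charInner (KacMultiplicity.permChar I v K κ)
        (fun g => (KacMultiplicity.linChar v α g : κ)) := by
    unfold KacMultiplicity.permChar
    rw [KacMultiplicity.charInner_card_fixedPoints, KacMultiplicity.numAbsIndecomposable]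
    simp only [KacMultiplicity.isAbsIndecomposable_iff hv hα]
    rfl
  refine ⟨h1, fun A hA => ?_, ?_⟩
  · rw [← h1, hA K, Rat.cast_natCast]
  · have : FiniteDimensional κ (MonoidAlgebra κ (KacMultiplicity.QuiverRep I v K)) :=
      Module.Finite.equiv (MonoidAlgebra.coeffLinearEquiv κ).symm
    rw [← KacMultiplicity.charInner_trace]
    simp only [KacMultiplicity.trace_ofMulAction]
    rfl
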